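/- Let $n,m,q\ge 0$ be integers, let $\mathcal A\subset\mathbb R^n$ be an open set containing $0$, and let $f:\mathcal A\to\mathbb R$, $h:\mathcal A\to\mathbb R^m$ and $g:\mathcal A\to\mathbb R^q$ be of class $C^2$, with $h(0)=0$ and $g(0)=0$. Suppose that $0$ is a local minimizer of the problem $$\text{minimize } f(x)\quad\text{subject to } h(x)=0,\ g(x)\le 0,\ x\in\mathcal A,$$ where inequalities between vectors are componentwise. Suppose that the Mangasarian–Fromovitz constraint qualification holds at $0$: $\operatorname{rank} Dh(0)=m$ and there exists $d\in\mathbb R^n$ with $Dh(0)d=0$ and $Dg(0)d<0$. Let $Dhg(x)=\begin{pmatrix}Dh(x)\\ Dg(x)\end{pmatrix}$ and suppose that $$\operatorname{rank} Dhg(x)\le \operatorname{rank} Dhg(0)+1\qquad\text{for all } x\in\mathcal A.$$ Then there exist Lagrange multipliers $\lambda\in\mathbb R^m$ and $\mu\in\mathbb R^q$ with $\mu\ge 0$, that is, with $$\nabla f(0)+\sum_{j=1}^m\lambda_j\nabla h_j(0)+\sum_{\ell=1}^q\mu_\ell\nabla g_\ell(0)=0,$$ such that $$d^{T}\Big(\nabla^2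 f(0)+\sum_{j=1}^m\lambda_j\nabla^2h_j(0)+\sum_{\ell=1}^q\mu_\ell\nabla^2g_\ell(0)\Big)d\ \ge\ 0$$ for all $d\in\mathbb R^n$ with $Dh(0)d=0$ and $Dg(0)d=0$. -/

import Mathlib

/-- Euclidean space of dimension `n`. -/
abbrev NLP.E (n : ℕ) : Type := EuclideanSpace ℝ (Fin n)

/-- The feasible set of: minimize `f x` subject to `h x = 0`, `g x ≤ 0` (componentwise), `x ∈ A`. -/
def NLP.feasibleSet {n m q : ℕ} (A : Set (NLP.E n)) (h : NLP.E n → NLP.E m)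
    (g : NLP.E n → NLP.E q) : Set (NLP.E n) :=
  {x | x ∈ A ∧ h x = 0 ∧ ∀ l, g x l ≤ 0}

/-- The combined derivative `Dhg(x)`, obtained by stacking `Dh(x)` on top of `Dg(x)`. -/
noncomputable def NLP.Dhg {n m q : ℕ} (h : NLP.E n → NLP.E m) (g : NLP.E n → NLP.E q)
    (x : NLP.E n) : NLP.E n →L[ℝ] NLP.E m × NLP.E q :=
  (fderiv ℝ h x).prod (fderiv ℝ g x)

/-- The rank of a linear map, as a natural number. -/
noncomputable def NLP.rank {n : ℕ} {F : Type*} [NormedAddCommGroup F] [NormedSpace ℝ F]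
    (L : NLP.E n →L[ℝ] F) : ℕ :=
  Module.finrank ℝ (LinearMap.range (L : NLP.E n →ₗ[ℝ] F))

/-- The Mangasarian-Fromovitz constraint qualification at the point `0`
(where all the constraints are active). -/
def NLP.MangasarianFromovitz {n m q : ℕ} (h : NLP.E n → NLP.E m) (g : NLP.E n → NLP.E q) : Prop :=
  NLP.rank (fderiv ℝ h 0) = m ∧
    ∃ d : NLP.E n, fderiv ℝ h 0 d = 0 ∧ ∀ l, fderiv ℝ g 0 d l < 0

/-- The Hessian matrix of `φ` at `x`, with entries `∂ᵢ ∂ⱼ φ (x)`. -/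
noncomputable def NLP.hessian {n : ℕ} (φ : NLP.E n → ℝ) (x : NLP.E n) :
    Matrix (Fin n) (Fin n) ℝ :=
  Matrix.of fun i j =>
    fderiv ℝ (fderiv ℝ φ) x (EuclideanSpace.single i 1) (EuclideanSpace.single j 1)

/-- The Hessian matrix at `0` of the Lagrangian `f + ∑ λⱼ hⱼ + ∑ μₗ gₗ`. -/
noncomputable def NLP.lagrangianHessian {n m q : ℕ} (f : NLP.E n → ℝ) (h : NLP.E n → NLP.E m)
    (g : NLP.E n → NLP.E q) (lam : Fin m → ℝ) (mu : Fin q → ℝ) : Matrix (Fin n) (Fin n) ℝ :=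
  NLP.hessian f 0 + ∑ j, lam j • NLP.hessian (fun x => h x j) 0
    + ∑ l, mu l • NLP.hessian (fun x => g x l) 0

/-- `(λ, μ)` is a pair of Lagrange multipliers at `0`: `μ ≥ 0` and the first order condition
`∇f(0) + ∑ λⱼ ∇hⱼ(0) + ∑ μₗ ∇gₗ(0) = 0` holds. -/
def NLP.IsLagrangeMultiplier {n m q : ℕ} (f : NLP.E n → ℝ) (h : NLP.E n → NLP.E m)
    (g : NLP.E n → NLP.E q) (lam : Fin m → ℝ) (mu : Fin q → ℝ) : Prop :=
  (∀ l, 0 ≤ mu l) ∧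
    gradient f 0 + ∑ j, lam j • gradient (fun x => h x j) 0
      + ∑ l, mu l • gradient (fun x => g x l) 0 = 0

/-!
Let `c = (h, g)` and let `K` be the kernel of `c'(0)`. The proof finds one multiplier for all
directions in `K` from three facts.

* For each single `d ∈ K` there is a multiplier whose Lagrangian has nonnegative second derivative
  along `d` (`NLP.exists_multiplier_of_direction`). A feasible arc with second order jet `(d, w)`
  cannot decrease `f` at second order, so a system of linear inequalities in `w` has no solution
  (`NLP.not_exists_second_order_descent`), and `motzkin_alternative` turns this into a multiplier.
* Two multipliers differ by a functional `η` annihilating the range of `c'(0)`, and their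
  Lagrangian Hessians on `K` differ by `η (c''(0) d d)`. Because the rank of `c'` increases by at
  most one near `0`, the map `u ↦ c''(0) z u` from `K` to the cokernel of `c'(0)` has rank at most
  one for every `z ∈ K` (`minor_eq_zero_of_finrank_le`). With the symmetry of `c''(0)` this forces
  all the forms `η (c''(0) d d)` to be proportional to a single form `H d d`
  (`exists_form_of_minors_eq_zero`).
* Hence on `K` the Lagrangian Hessians form a family `P + t H` with a scalar parameter `t`, an
  affine function of the multiplier. The multipliers form a compact convex set by the
  Mangasarian-Fromovitz condition, so `t` ranges over a compact interval. For such a family, the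
  existence of a good `t` for each `d` implies the existence of one good `t` for all `d`
  (`exists_parameter_forall_nonneg`).
-/

section
open Filter Topology Set Asymptotics

/-! ### One-parameter families of quadratic forms -/

/-- Exchange of quantifiers for a one-parameter family of quadratic forms `P + t H`, where `t` ranges
over a compact interval. If no `t` works for all `d`, every `t` has a witness `d` of negativity,
with `H d d ≥ 0` or with `H d d ≤ 0`. Both kinds occur, at the two ends of the interval, and each is
an open condition on `t`, so by connectedness some `t` has witnesses of both kinds. On the segment
joining the two there is a zero of `H` at which `P` is negative, whatever the parameter. -/
theorem exists_parameter_forall_nonneg {V : Type*} [NormedAddCommGroup V] [NormedSpace ℝ V]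
    (K : Submodule ℝ V) (P H : V →L[ℝ] V →L[ℝ] ℝ)
    (hP : ∀ u v, P u v = P v u) (hH : ∀ u v, H u v = H v u)
    {T : Set ℝ} (hTc : IsCompact T) (hTconv : Convex ℝ T)
    (hex : ∀ d ∈ K, ∃ t ∈ T, 0 ≤ P d d + t * H d d) :
    ∃ t ∈ T, ∀ d ∈ K, 0 ≤ P d d + t * H d d := by
  by_contra! hcon
  obtain ⟨t₀, ht₀, -⟩ := hex 0 K.zero_mem
  have hne : T.Nonempty := ⟨t₀, ht₀⟩
  let U : Set ℝ := ⋃ d ∈ {d | d ∈ K ∧ 0 ≤ H d d}, {t | P d d + t * H d d < 0}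
  let W : Set ℝ := ⋃ d ∈ {d | d ∈ K ∧ H d d ≤ 0}, {t | P d d + t * H d d < 0}
  have hopen : ∀ d, IsOpen {t : ℝ | P d d + t * H d d < 0} := fun d =>
    isOpen_lt (by fun_prop) continuous_const
  have hU : IsOpen U := isOpen_biUnion fun d _ => hopen d
  have hW : IsOpen W := isOpen_biUnion fun d _ => hopen d
  have hcover : T ⊆ U ∪ W := by
    intro t ht
    obtain ⟨d, hd, hneg⟩ := hcon t ht
    rcases le_total 0 (H d d) with h | h
    · exact Or.inl (mem_biUnion (x := d) ⟨hd, h⟩ hneg)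
    · exact Or.inr (mem_biUnion (x := d) ⟨hd, h⟩ hneg)
  have hTU : (T ∩ U).Nonempty := by
    obtain ⟨a, ha, hmin⟩ := hTc.exists_isLeast hne
    obtain ⟨d, hd, hneg⟩ := hcon a ha
    rcases le_total 0 (H d d) with h | h
    · exact ⟨a, ha, mem_biUnion (x := d) ⟨hd, h⟩ hneg⟩
    · obtain ⟨t, ht, hnn⟩ := hex d hd
      have := mul_le_mul_of_nonpos_right (hmin ht) h
      linarith
  have hTW : (T ∩ W).Nonempty := by
    obtain ⟨b, hb, hmax⟩ := hTc.exists_isGreatest hne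
    obtain ⟨d, hd, hneg⟩ := hcon b hb
    rcases le_total 0 (H d d) with h | h
    · obtain ⟨t, ht, hnn⟩ := hex d hd
      have := mul_le_mul_of_nonneg_right (hmax ht) h
      linarith
    · exact ⟨b, hb, mem_biUnion (x := d) ⟨hd, h⟩ hneg⟩
  obtain ⟨t, -, htU, htW⟩ := hTconv.isPreconnected U W hU hW hcover hTU hTW
  simp only [U, W, mem_iUnion, mem_ofPred_eq, exists_prop] at htU htW
  obtain ⟨d₁, ⟨hd₁, hH₁⟩, hn₁⟩ := htU
  obtain ⟨d₂', ⟨hd₂', hH₂'⟩, hn₂'⟩ := htW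
  -- Replacing `d₂` by its negative if needed, the cross term of `P + t H` is nonpositive.
  obtain ⟨d₂, hd₂, hH₂, hn₂, hcross⟩ : ∃ d₂ ∈ K, H d₂ d₂ ≤ 0 ∧ P d₂ d₂ + t * H d₂ d₂ < 0 ∧
      P d₁ d₂ + t * H d₁ d₂ ≤ 0 := by
    rcases le_total (P d₁ d₂' + t * H d₁ d₂') 0 with h | h
    · exact ⟨d₂', hd₂', hH₂', hn₂', h⟩
    · exact ⟨-d₂', K.neg_mem hd₂', by simpa using hH₂', by simpa using hn₂', by
        simp only [map_neg]; linarith⟩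
  let γ : ℝ → V := fun s => (1 - s) • d₁ + s • d₂
  have hγc : Continuous fun s => H (γ s) (γ s) := by fun_prop
  obtain ⟨s, ⟨hs0, hs1⟩, hs⟩ : (0 : ℝ) ∈ (fun s => H (γ s) (γ s)) '' Icc 0 1 :=
    intermediate_value_Icc' zero_le_one hγc.continuousOn (by simp [γ, hH₁, hH₂])
  obtain ⟨t', -, ht'⟩ := hex (γ s) (K.add_mem (K.smul_mem _ hd₁) (K.smul_mem _ hd₂))
  have hs' : H (γ s) (γ s) = 0 := hs
  rw [hs', mul_zero, add_zero] at ht'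
  have hexp : P (γ s) (γ s) + t * H (γ s) (γ s) = (1 - s) ^ 2 * (P d₁ d₁ + t * H d₁ d₁)
      + 2 * ((1 - s) * s) * (P d₁ d₂ + t * H d₁ d₂) + s ^ 2 * (P d₂ d₂ + t * H d₂ d₂) := by
    simp only [γ, map_add, map_smul, add_apply, smul_apply,
      smul_eq_mul, hP d₂ d₁, hH d₂ d₁]
    ring
  rw [hs', mul_zero, add_zero] at hexp
  have h2 : 2 * ((1 - s) * s) * (P d₁ d₂ + t * H d₁ d₂) ≤ 0 :=
    mul_nonpos_of_nonneg_of_nonpos (by nlinarith) hcross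
  rcases eq_or_lt_of_le hs0 with h0 | h0
  · subst h0; norm_num at hexp; linarith
  · have h3 := mul_neg_of_pos_of_neg (pow_pos h0 2) hn₂
    have h1 := mul_nonpos_of_nonneg_of_nonpos (sq_nonneg (1 - s)) hn₁.le
    linarith

/-! ### Bilinear maps of rank one modulo a subspace -/

/-- If the linear maps `B z`, tested against functionals in `N`, have all their `2 × 2` minors equal
to zero, then the quadratic forms `d ↦ η (B d d)`, for `η ∈ N`, are all multiples of a single one,
and the factor is the value of `η` at a fixed vector. -/
theorem exists_form_of_minors_eq_zero {V W : Type*} [NormedAddCommGroup V] [NormedSpace ℝ V]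
    [NormedAddCommGroup W] [NormedSpace ℝ W]
    (K : Submodule ℝ V) (N : Set (W →L[ℝ] ℝ)) (B : V →L[ℝ] V →L[ℝ] W)
    (hB : ∀ u v, B u v = B v u)
    (hminor : ∀ η₁ ∈ N, ∀ η₂ ∈ N, ∀ z ∈ K, ∀ u₁ ∈ K, ∀ u₂ ∈ K,
      η₁ (B z u₁) * η₂ (B z u₂) = η₁ (B z u₂) * η₂ (B z u₁)) :
    ∃ (φ : W →L[ℝ] ℝ) (w : W), ∀ η ∈ N, ∀ d ∈ K, η (B d d) = η w * φ (B d d) := by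
  by_cases hzero : ∀ φ ∈ N, ∀ z ∈ K, φ (B z z) = 0
  · exact ⟨0, 0, fun η hη d hd => by simp [hzero η hη d hd]⟩
  push Not at hzero
  obtain ⟨φ, hφ, z₀, hz₀, hne⟩ := hzero
  refine ⟨(φ (B z₀ z₀))⁻¹ • φ, B z₀ z₀, fun η hη d hd => ?_⟩
  set c := φ (B z₀ z₀) with hc
  -- The form `e = c η B - η(w) φ B` has `z₀` in its kernel.
  let e : V → V → ℝ := fun u v => c * η (B u v) - η (B z₀ z₀) * φ (B u v)
  have he₀ : ∀ u ∈ K, e z₀ u = 0 := fun u hu => by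
    have := hminor η hη φ hφ z₀ hz₀ z₀ hz₀ u hu
    simp only [e]; linarith
  have hminor' : ∀ z ∈ K, φ (B z z₀) ≠ 0 → e z z = 0 := fun z hz hzne => by
    have h1 := hminor η hη φ hφ z hz z hz z₀ hz₀
    have h0 : e z z₀ = 0 := by
      have := he₀ z hz
      simpa only [e, hB z z₀] using this
    have : e z z * φ (B z z₀) = e z z₀ * φ (B z z) := by
      simp only [e]; linear_combination c * h1
    rw [h0, zero_mul] at this
    exact (mul_eq_zero.1 this).resolve_right hzne
  have he : e d d = 0 := by
    by_cases hd0 : φ (B d z₀) = 0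
    · have h1 := hminor' (d + z₀) (K.add_mem hd hz₀) (by simpa [hd0] using hne)
      have h2 := he₀ d hd
      have h3 := he₀ z₀ hz₀
      simp only [e, map_add, add_apply, hB d z₀] at h1 h2 h3 ⊢
      linarith
    · exact hminor' d hd hd0
  simp only [e] at he
  simp only [smul_apply, smul_eq_mul]
  field_simp
  linarith

/-- If the rank of `D x` exceeds that of `D 0` by at most one near `0`, then the derivative `B` of `D`
at `0` induces maps `B z : ker (D 0) → W / range (D 0)` of rank at most one: their `2 × 2` minors
vanish. Otherwise a basis of `range (D 0)` and two vectors `B z u₁`, `B z u₂` would be linearly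
independent, and so would be nearby vectors taken in the range of `D (t z)` for small `t`. -/
theorem minor_eq_zero_of_finrank_le {V W : Type*} [NormedAddCommGroup V] [NormedSpace ℝ V]
    [FiniteDimensional ℝ V] [NormedAddCommGroup W] [NormedSpace ℝ W]
    {D : V → V →L[ℝ] W} {B : V →L[ℝ] V →L[ℝ] W} (hD : HasFDerivAt D B 0)
    (hrank : ∀ᶠ x in 𝓝 0, Module.finrank ℝ (LinearMap.range (D x : V →ₗ[ℝ] W)) ≤
      Module.finrank ℝ (LinearMap.range (D 0 : V →ₗ[ℝ] W)) + 1)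
    {η₁ η₂ : W →L[ℝ] ℝ} (hη₁ : ∀ v, η₁ (D 0 v) = 0) (hη₂ : ∀ v, η₂ (D 0 v) = 0)
    {z u₁ u₂ : V} (hu₁ : D 0 u₁ = 0) (hu₂ : D 0 u₂ = 0) :
    η₁ (B z u₁) * η₂ (B z u₂) = η₁ (B z u₂) * η₂ (B z u₁) := by
  by_contra hne
  let R := LinearMap.range (D 0 : V →ₗ[ℝ] W)
  let b := Module.finBasis ℝ R
  have hb : ∀ i, ∃ v, D 0 v = (b i : W) := fun i => (b i).2
  choose e he using hb
  let u : Fin 2 → V := ![u₁, u₂]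
  -- Vectors in the range of `D (t z)`, those coming from `ker (D 0)` being divided by `t`,
  -- and their limit as `t → 0`.
  let col : ℝ → Fin (Module.finrank ℝ R) ⊕ Fin 2 → W := fun t =>
    Sum.elim (fun i => D (t • z) (e i)) (fun j => t⁻¹ • D (t • z) (u j))
  let lim : Fin (Module.finrank ℝ R) ⊕ Fin 2 → W :=
    Sum.elim (fun i => D 0 (e i)) (fun j => B z (u j))
  have hline : HasDerivAt (fun t : ℝ => D (t • z)) (B z) 0 := by
    have h1 : HasDerivAt (fun t : ℝ => t • z) z 0 := by
      simpa using (hasDerivAt_id (0 : ℝ)).smul_const z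
    have h2 : HasFDerivAt D B ((0 : ℝ) • z) := by simpa using hD
    exact h2.comp_hasDerivAt (0 : ℝ) h1
  have htend : Tendsto col (𝓝[≠] 0) (𝓝 lim) := by
    rw [tendsto_pi_nhds]
    rintro (i | j)
    · have := (hline.continuousAt.clm_apply (continuousAt_const (y := e i))).tendsto
      simp only [zero_smul] at this
      exact this.mono_left nhdsWithin_le_nhds
    · have h1 := (hline.clm_apply (hasDerivAt_const (0 : ℝ) (u j))).tendsto_slope_zero
      have h0 : D 0 (u j) = 0 := by fin_cases j <;> simp [u, hu₁, hu₂]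
      simpa [col, lim, h0] using h1
  have hlim : LinearIndependent ℝ lim := by
    rw [Fintype.linearIndependent_iff]
    intro a ha
    simp only [lim, Fintype.sum_sum_type, Sum.elim_inl, Sum.elim_inr, Fin.sum_univ_two, u,
      Matrix.cons_val_zero, Matrix.cons_val_one] at ha
    have e1 := congrArg η₁ ha
    have e2 := congrArg η₂ ha
    simp only [map_add, map_sum, map_smul, hη₁, hη₂, smul_eq_mul, mul_zero,
      Finset.sum_const_zero, zero_add, map_zero] at e1 e2
    have a0 : a (Sum.inr 0) = 0 := by
      have : a (Sum.inr 0) * (η₁ (B z u₁) * η₂ (B z u₂) - η₁ (B z u₂) * η₂ (B z u₁)) = 0 := by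
        linear_combination η₂ (B z u₂) * e1 - η₁ (B z u₂) * e2
      exact (mul_eq_zero.1 this).resolve_right (sub_ne_zero.2 hne)
    have a1 : a (Sum.inr 1) = 0 := by
      have : a (Sum.inr 1) * (η₁ (B z u₁) * η₂ (B z u₂) - η₁ (B z u₂) * η₂ (B z u₁)) = 0 := by
        linear_combination η₁ (B z u₁) * e2 - η₂ (B z u₁) * e1
      exact (mul_eq_zero.1 this).resolve_right (sub_ne_zero.2 hne)
    have hsum : ∑ i, a (Sum.inl i) • b i = 0 := by
      apply Subtype.ext
      simpa [a0, a1, he] using ha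
    have hb0 := Fintype.linearIndependent_iff.1 b.linearIndependent _ hsum
    rintro (i | j)
    · exact hb0 i
    · fin_cases j
      · exact a0
      · exact a1
  have hsmall : Tendsto (fun t : ℝ => t • z) (𝓝[≠] 0) (𝓝 0) := by
    have : Continuous fun t : ℝ => t • z := by fun_prop
    simpa using (this.tendsto 0).mono_left nhdsWithin_le_nhds
  obtain ⟨t, hind, hle⟩ := ((htend.eventually hlim.eventually).and
    (hsmall.eventually hrank)).exists
  have hmem : ∀ k, col t k ∈ LinearMap.range (D (t • z) : V →ₗ[ℝ] W) := by
    rintro (i | j)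
    · exact ⟨e i, rfl⟩
    · exact ⟨t⁻¹ • u j, by simp [col]⟩
  have hind' : LinearIndependent ℝ
      (fun k => (⟨col t k, hmem k⟩ : LinearMap.range (D (t • z) : V →ₗ[ℝ] W))) :=
    LinearIndependent.of_comp (Submodule.subtype _) hind
  have hcard := hind'.fintype_card_le_finrank
  simp only [Fintype.card_sum, Fintype.card_fin] at hcard
  have : Module.finrank ℝ R = Module.finrank ℝ (LinearMap.range (D 0 : V →ₗ[ℝ] W)) := rfl
  omega

/-! ### A theorem of the alternative -/

theorem nonneg_of_forall_pos_add_mul {k x : ℝ} (h : ∀ s > 0, 0 ≤ k + s * x) : 0 ≤ k ∧ 0 ≤ x := by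
  constructor
  · have h1 : Tendsto (fun s : ℝ => k + s * x) (𝓝[>] 0) (𝓝 k) := by
      have : Continuous fun s : ℝ => k + s * x := by fun_prop
      simpa using (this.tendsto 0).mono_left nhdsWithin_le_nhds
    exact ge_of_tendsto h1 (eventually_mem_nhdsWithin.mono fun s hs => h s hs)
  · by_contra! hx
    have h1 := h ((|k| + 1) / (-x)) (div_pos (by positivity) (by linarith))
    have h2 : (|k| + 1) / (-x) * x = -(|k| + 1) := by field_simp [hx.ne]
    have := le_abs_self k
    linarith

theorem eq_zero_of_forall_nonneg_add_mul {k x : ℝ} (h : ∀ s, 0 ≤ k + s * x) : x = 0 := by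
  refine le_antisymm ?_ (nonneg_of_forall_pos_add_mul fun s _ => h s).2
  have := (nonneg_of_forall_pos_add_mul (k := k) (x := -x) fun s _ => by
    simpa using h (-s)).2
  linarith

/-- Motzkin's theorem of the alternative for an affine system, with the objective normalised to have
coefficient one: if `A w + a = 0`, `G w + b < 0`, `F w + c < 0` has no solution, a convex separation
gives a nonnegative combination of the inequalities that is nonnegative on `A w + a = 0`. The
Mangasarian-Fromovitz direction forces the coefficient of `F` to be positive. -/
theorem motzkin_alternative {V Y ι : Type*} [Fintype ι]
    [NormedAddCommGroup V] [NormedSpace ℝ V] [NormedAddCommGroup Y] [NormedSpace ℝ Y]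
    {A : V →L[ℝ] Y} (hA : Function.Surjective A) (F : V →L[ℝ] ℝ)
    (G : V →L[ℝ] EuclideanSpace ℝ ι) (a : Y) (b : EuclideanSpace ℝ ι) (c : ℝ)
    (hMF : ∃ d, A d = 0 ∧ ∀ l, G d l < 0)
    (hno : ¬ ∃ w, A w + a = 0 ∧ (∀ l, G w l + b l < 0) ∧ F w + c < 0) :
    ∃ μ : ι → ℝ, (∀ l, 0 ≤ μ l) ∧
      ∀ w, A w + a = 0 → 0 ≤ F w + c + ∑ l, μ l * (G w l + b l) := by
  classical
  -- The open convex set of strict upper bounds for the values of the system.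
  let U : Set (ℝ × (ι → ℝ)) :=
    {y | ∃ w, A w + a = 0 ∧ F w + c < y.1 ∧ ∀ l, G w l + b l < y.2 l}
  have hUo : IsOpen U := by
    have : U = ⋃ w ∈ {w | A w + a = 0},
        {y : ℝ × (ι → ℝ) | F w + c < y.1 ∧ ∀ l, G w l + b l < y.2 l} := by
      ext y
      simp only [U, mem_ofPred_eq, mem_iUnion, exists_prop]
    rw [this]
    refine isOpen_biUnion fun w _ => (isOpen_lt continuous_const continuous_fst).inter ?_
    have : {y : ℝ × (ι → ℝ) | ∀ l, G w l + b l < y.2 l} =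
        ⋂ l, {y | G w l + b l < y.2 l} := by ext; simp
    change IsOpen {y : ℝ × (ι → ℝ) | ∀ l, G w l + b l < y.2 l}
    rw [this]
    exact isOpen_iInter_of_finite fun l => isOpen_lt continuous_const (by fun_prop)
  have hUc : Convex ℝ U := by
    rintro y ⟨w, hw, hy, hy'⟩ y₂ ⟨w₂, hw₂, hy₂, hy₂'⟩ s s₂ hs hs₂ hss
    -- A strict inequality survives a convex combination.
    have key : ∀ {p q p₂ q₂ : ℝ}, p < q → p₂ < q₂ → s * p + s₂ * p₂ < s * q + s₂ * q₂ := by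
      intro p q p₂ q₂ h h₂
      rcases eq_or_lt_of_le hs with h0 | h0
      · have : s₂ = 1 := by linarith
        subst h0 this; linarith
      · have := mul_lt_mul_of_pos_left h h0
        have := mul_le_mul_of_nonneg_left h₂.le hs₂
        linarith
    refine ⟨s • w + s₂ • w₂, ?_, ?_, fun l => ?_⟩
    · have : A (s • w + s₂ • w₂) + a = s • (A w + a) + s₂ • (A w₂ + a) := by
        simp only [map_add, map_smul, smul_add]
        nth_rewrite 1 [← one_smul ℝ a, ← hss, add_smul]
        abel
      rw [this, hw, hw₂]; simp
    · have := key hy hy₂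
      simp only [map_add, map_smul, smul_eq_mul, Prod.fst_add, Prod.smul_fst]
      linear_combination this - c * hss
    · have := key (hy' l) (hy₂' l)
      simp only [map_add, map_smul, smul_eq_mul, Prod.snd_add, Prod.smul_snd, PiLp.add_apply,
        PiLp.smul_apply, Pi.add_apply, Pi.smul_apply]
      linear_combination this - b l * hss
  have h0U : (0 : ℝ × (ι → ℝ)) ∉ U := by
    rintro ⟨w, hw, h1, h2⟩
    exact hno ⟨w, hw, fun l => by simpa using h2 l, by simpa using h1⟩
  obtain ⟨ν, hν⟩ := geometric_hahn_banach_point_open hUc hUo h0U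
  simp only [map_zero] at hν
  set ν₀ := ν (1, 0) with hν₀
  let ν' : ι → ℝ := fun l => ν (0, Pi.single l 1)
  have hform : ∀ (p : ℝ) (r : ι → ℝ), ν (p, r) = ν₀ * p + ∑ l, ν' l * r l := by
    intro p r
    have h1 : ((p, r) : ℝ × (ι → ℝ)) = p • (1, 0) + ∑ l, r l • (0, Pi.single l 1) := by
      ext l
      · simp [Prod.fst_sum]
      · simp [Prod.snd_sum, Finset.sum_apply, Pi.single_apply]
    rw [h1]
    simp only [map_add, map_sum, map_smul, smul_eq_mul, ν', hν₀, mul_comm]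
  obtain ⟨w₀, hw₀⟩ : ∃ w, A w + a = 0 := by
    obtain ⟨w, hw⟩ := hA (-a)
    exact ⟨w, by rw [hw]; simp⟩
  have hval : ∀ w, A w + a = 0 → ∀ (p : ℝ) (r : ι → ℝ), 0 < p → (∀ l, 0 < r l) →
      0 < ν₀ * (F w + c) + ∑ l, ν' l * (G w l + b l) + (ν₀ * p + ∑ l, ν' l * r l) := by
    intro w hw p r hp hr
    have := hν (F w + c + p, fun l => G w l + b l + r l)
      ⟨w, hw, by simpa using hp, fun l => by simpa using hr l⟩
    rw [hform] at this
    simp only [mul_add, Finset.sum_add_distrib] at this ⊢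
    linarith
  have hν₀nn : 0 ≤ ν₀ := by
    refine (nonneg_of_forall_pos_add_mul (k := ν₀ * (F w₀ + c) +
      ∑ l, ν' l * (G w₀ l + b l) + (∑ l, ν' l)) fun s hs => ?_).2
    have := hval w₀ hw₀ s 1 hs (fun _ => one_pos)
    simp only [Pi.one_apply, mul_one] at this
    linarith
  have hν'nn : ∀ l, 0 ≤ ν' l := by
    intro j
    refine (nonneg_of_forall_pos_add_mul (k := ν₀ * (F w₀ + c) +
      ∑ l, ν' l * (G w₀ l + b l) + (ν₀ + ∑ l, ν' l)) fun s hs => ?_).2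
    have := hval w₀ hw₀ 1 (1 + Pi.single j s) one_pos (fun l => by
      have : 0 ≤ (Pi.single j s : ι → ℝ) l := by
        rw [Pi.single_apply]; split_ifs <;> linarith
      simp only [Pi.add_apply, Pi.one_apply]; linarith)
    simp only [Pi.add_apply, Pi.one_apply, mul_add, Finset.sum_add_distrib, mul_one,
      Pi.single_apply, mul_ite, mul_zero, Finset.sum_ite_eq', Finset.mem_univ, if_true] at this
    simp only [mul_add, Finset.sum_add_distrib]
    linarith
  have hge : ∀ w, A w + a = 0 → 0 ≤ ν₀ * (F w + c) + ∑ l, ν' l * (G w l + b l) := by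
    intro w hw
    refine (nonneg_of_forall_pos_add_mul (x := ν₀ + ∑ l, ν' l) fun s hs => ?_).1
    have := hval w hw s (fun _ => s) hs (fun _ => hs)
    rw [← Finset.sum_mul] at this
    linarith
  have hν₀pos : 0 < ν₀ := by
    refine lt_of_le_of_ne hν₀nn fun h0 => ?_
    obtain ⟨d, hd, hdneg⟩ := hMF
    have h1 : 0 ≤ ∑ l, ν' l * G d l := by
      refine (nonneg_of_forall_pos_add_mul
        (k := ∑ l, ν' l * (G w₀ l + b l)) fun s _ => ?_).2
      have := hge (w₀ + s • d) (by simp [hd, hw₀])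
      rw [← h0, zero_mul, zero_add] at this
      refine this.trans_eq ?_
      rw [Finset.mul_sum, ← Finset.sum_add_distrib]
      refine Finset.sum_congr rfl fun l _ => ?_
      simp only [map_add, map_smul, PiLp.add_apply, PiLp.smul_apply, smul_eq_mul]; ring
    have h2 : ∀ l ∈ Finset.univ, ν' l * G d l ≤ 0 := fun l _ =>
      mul_nonpos_of_nonneg_of_nonpos (hν'nn l) (hdneg l).le
    have h3 := (Finset.sum_eq_zero_iff_of_nonpos h2).1
      (le_antisymm (Finset.sum_nonpos h2) h1)
    have h4 : ∀ l, ν' l = 0 := fun l =>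
      (mul_eq_zero.1 (h3 l (Finset.mem_univ l))).resolve_right (hdneg l).ne
    have := hval w₀ hw₀ 1 1 one_pos (fun _ => one_pos)
    simp [h4, ← h0] at this
  -- Divide by the coefficient of the objective.
  refine ⟨fun l => ν' l / ν₀, fun l => div_nonneg (hν'nn l) hν₀nn, fun w hw => ?_⟩
  have h1 := div_nonneg (hge w hw) hν₀nn
  rw [add_div, mul_div_cancel_left₀ _ hν₀pos.ne', Finset.sum_div] at h1
  simpa only [div_mul_eq_mul_div] using h1

/-! ### The set of multipliers -/

/-- The set of inequality parts `μ` of the Lagrange multipliers, for an objective with derivative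
`F` and constraints with derivatives `A` (equalities) and `G` (inequalities). The existence of the
equality part is encoded as the vanishing of `F + ∑ μₗ Gₗ` on the kernel of `A`. -/
def NLP.multiplierSet {V Y ι : Type*} [Fintype ι]
    [NormedAddCommGroup V] [NormedSpace ℝ V] [NormedAddCommGroup Y] [NormedSpace ℝ Y]
    (A : V →L[ℝ] Y) (F : V →L[ℝ] ℝ) (G : V →L[ℝ] EuclideanSpace ℝ ι) : Set (ι → ℝ) :=
  {μ | (∀ l, 0 ≤ μ l) ∧ ∀ v, A v = 0 → F v + ∑ l, μ l * G v l = 0}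

section
variable {V Y ι : Type*} [Fintype ι]
    [NormedAddCommGroup V] [NormedSpace ℝ V] [NormedAddCommGroup Y] [NormedSpace ℝ Y]
    {A : V →L[ℝ] Y} {F : V →L[ℝ] ℝ} {G : V →L[ℝ] EuclideanSpace ℝ ι}

theorem NLP.convex_multiplierSet : Convex ℝ (NLP.multiplierSet A F G) := by
  rintro μ ⟨hμ, hμ'⟩ ν ⟨hν, hν'⟩ s t hs ht hst
  refine ⟨fun l => add_nonneg (mul_nonneg hs (hμ l)) (mul_nonneg ht (hν l)), fun v hv => ?_⟩
  have h1 := hμ' v hv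
  have h2 := hν' v hv
  simp only [Pi.add_apply, Pi.smul_apply, smul_eq_mul, add_mul, mul_assoc,
    Finset.sum_add_distrib, ← Finset.mul_sum]
  linear_combination s * h1 + t * h2 - F v * hst

/-- Evaluating the stationarity condition at a Mangasarian-Fromovitz direction bounds each `μₗ`. -/
theorem NLP.isCompact_multiplierSet (hMF : ∃ d, A d = 0 ∧ ∀ l, G d l < 0) :
    IsCompact (NLP.multiplierSet A F G) := by
  obtain ⟨d, hd, hneg⟩ := hMF
  have hclosed : IsClosed (NLP.multiplierSet A F G) := by
    have : NLP.multiplierSet A F G = (⋂ l, {μ | 0 ≤ μ l}) ∩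
        ⋂ v ∈ {v | A v = 0}, {μ | F v + ∑ l, μ l * G v l = 0} := by
      ext; simp [NLP.multiplierSet]
    rw [this]
    exact (isClosed_iInter fun l => isClosed_le continuous_const (by fun_prop)).inter
      (isClosed_biInter fun v _ => isClosed_eq (by fun_prop) continuous_const)
  refine (isCompact_univ_pi (s := fun l => Icc 0 (F d / -(G d l)))
    fun l => isCompact_Icc).of_isClosed_subset hclosed ?_
  rintro μ ⟨hμ, hμ'⟩ j -
  refine ⟨hμ j, (le_div_iff₀ (by linarith [hneg j])).2 ?_⟩
  have h1 := hμ' d hd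
  have h2 : μ j * -(G d j) ≤ ∑ l, μ l * -(G d l) :=
    Finset.single_le_sum (f := fun l => μ l * -(G d l))
      (fun l _ => mul_nonneg (hμ l) (by linarith [hneg l])) (Finset.mem_univ j)
  simp only [mul_neg, Finset.sum_neg_distrib] at h2 ⊢
  linarith
end

section
variable {V Y ι : Type*} [Fintype ι]
    [NormedAddCommGroup V] [NormedSpace ℝ V] [NormedAddCommGroup Y] [NormedSpace ℝ Y]
    {A : V →L[ℝ] Y} {F : V →L[ℝ] ℝ} {G : V →L[ℝ] EuclideanSpace ℝ ι}

theorem NLP.mem_multiplierSet_of_forall_nonneg (hA : Function.Surjective A) {a : Y}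
    {b : EuclideanSpace ℝ ι} {c : ℝ} {μ : ι → ℝ} (hμ : ∀ l, 0 ≤ μ l)
    (h : ∀ w, A w + a = 0 → 0 ≤ F w + c + ∑ l, μ l * (G w l + b l)) :
    μ ∈ NLP.multiplierSet A F G := by
  refine ⟨hμ, fun v hv => ?_⟩
  obtain ⟨w, hw⟩ := hA (-a)
  refine eq_zero_of_forall_nonneg_add_mul
    (k := F w + c + ∑ l, μ l * (G w l + b l)) fun s => ?_
  refine (h (w + s • v) (by simp [hv, hw])).trans_eq ?_
  simp only [map_add, map_smul, smul_eq_mul, PiLp.add_apply, PiLp.smul_apply, mul_add,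
    Finset.sum_add_distrib, mul_left_comm _ s, Finset.mul_sum]
  ring

theorem NLP.exists_equality_multiplier [FiniteDimensional ℝ Y] (hA : Function.Surjective A)
    {μ : ι → ℝ} (hμ : μ ∈ NLP.multiplierSet A F G) :
    ∃ Λ : Y →L[ℝ] ℝ, ∀ v, F v + Λ (A v) + ∑ l, μ l * G v l = 0 := by
  obtain ⟨S, hS⟩ := (A : V →ₗ[ℝ] Y).exists_rightInverse_of_surjective (LinearMap.range_eq_top.2 hA)
  have hS' : ∀ y, A (S y) = y := fun y => LinearMap.congr_fun hS y
  let L : V →ₗ[ℝ] ℝ :=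
    (F + ∑ l, μ l • (EuclideanSpace.proj l : EuclideanSpace ℝ ι →L[ℝ] ℝ).comp G : V →L[ℝ] ℝ)
  have hL : ∀ v, L v = F v + ∑ l, μ l * G v l := fun v => by simp [L]
  refine ⟨LinearMap.toContinuousLinearMap (-(L ∘ₗ S)), fun v => ?_⟩
  have h1 : L (v - S (A v)) = 0 := by
    rw [hL]
    exact hμ.2 _ (by simp [hS'])
  rw [map_sub, hL v] at h1
  simp only [LinearMap.coe_toContinuousLinearMap', LinearMap.neg_apply, LinearMap.comp_apply]
  linarith
end

/-! ### Second order expansions and feasible arcs -/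

theorem ContDiffAt.hasFDerivAt_fderiv {V W : Type*} [NormedAddCommGroup V] [NormedSpace ℝ V]
    [NormedAddCommGroup W] [NormedSpace ℝ W] {f : V → W} {x : V} (hf : ContDiffAt ℝ 2 f x) :
    HasFDerivAt (fderiv ℝ f) (fderiv ℝ (fderiv ℝ f) x) x :=
  ((hf.fderiv_right (m := 1) (by norm_num)).differentiableAt (by norm_num)).hasFDerivAt

theorem ContDiffAt.fderiv_fderiv_comm {V W : Type*} [NormedAddCommGroup V] [NormedSpace ℝ V]
    [NormedAddCommGroup W] [NormedSpace ℝ W] {f : V → W} {x : V} (hf : ContDiffAt ℝ 2 f x)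
    (u v : V) : fderiv ℝ (fderiv ℝ f) x u v = fderiv ℝ (fderiv ℝ f) x v u :=
  hf.isSymmSndFDerivAt (by simp) u v

/-- Second order Taylor expansion with Peano remainder. The mean value inequality is applied to the
remainder, whose derivative at `y` is `f' y - f' 0 - f'' y = o(‖y‖)`. -/
theorem ContDiffAt.taylor_two_isLittleO {V W : Type*} [NormedAddCommGroup V] [NormedSpace ℝ V]
    [NormedAddCommGroup W] [NormedSpace ℝ W] {f : V → W} (hf : ContDiffAt ℝ 2 f 0) :
    (fun x => f x - f 0 - fderiv ℝ f 0 x - (1 / 2 : ℝ) • fderiv ℝ (fderiv ℝ f) 0 x x)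
      =o[𝓝 0] fun x => ‖x‖ ^ 2 := by
  set B := fderiv ℝ (fderiv ℝ f) 0
  have hsymm : ∀ u v, B u v = B v u := hf.fderiv_fderiv_comm
  have hB : HasFDerivAt (fderiv ℝ f) B 0 := hf.hasFDerivAt_fderiv
  have hdiff : ∀ᶠ x in 𝓝 (0 : V), DifferentiableAt ℝ f x :=
    (hf.eventually (by simp)).mono fun x hx => hx.differentiableAt (by norm_num)
  rw [isLittleO_iff]
  intro c hc
  have hsmall := hB.isLittleO.def hc
  simp only [sub_zero] at hsmall
  obtain ⟨ε, hε, hball⟩ := Metric.eventually_nhds_iff_ball.1 (hdiff.and hsmall)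
  filter_upwards [Metric.ball_mem_nhds (0 : V) hε] with x hx
  let R : V → W := fun y => f y - f 0 - fderiv ℝ f 0 y - (1 / 2 : ℝ) • B y y
  have hsub : Metric.closedBall (0 : V) ‖x‖ ⊆ Metric.ball 0 ε := by
    intro y hy
    simp only [Metric.mem_closedBall, dist_zero_right, Metric.mem_ball] at *
    linarith
  have hR : ∀ y ∈ Metric.closedBall (0 : V) ‖x‖,
      HasFDerivWithinAt R (fderiv ℝ f y - fderiv ℝ f 0 - B y) (Metric.closedBall 0 ‖x‖) y := by
    intro y hy
    have h1 := (hball y (hsub hy)).1.hasFDerivAt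
    have h2 : HasFDerivAt (fun y => B y y) (B y + B.flip y) y := by
      have := B.hasFDerivAt (x := y)
      refine (this.clm_apply (hasFDerivAt_id y)).congr_fderiv ?_
      ext v; simp
    refine HasFDerivAt.hasFDerivWithinAt ((((h1.sub_const (f 0)).sub
      (fderiv ℝ f 0).hasFDerivAt).sub (h2.const_smul (1 / 2 : ℝ))).congr_fderiv ?_)
    ext v
    simp only [sub_apply, smul_apply, add_apply, ContinuousLinearMap.flip_apply, hsymm v y,
      ← two_smul ℝ (B y v), smul_smul]
    norm_num
  have hbound : ∀ y ∈ Metric.closedBall (0 : V) ‖x‖,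
      ‖fderiv ℝ f y - fderiv ℝ f 0 - B y‖ ≤ c * ‖x‖ := by
    intro y hy
    refine (hball y (hsub hy)).2.trans ?_
    gcongr
    simpa using hy
  have := (convex_closedBall (0 : V) ‖x‖).norm_image_sub_le_of_norm_hasFDerivWithin_le hR hbound
    (x := 0) (y := x) (by simp) (by simp)
  simp only [R, sub_self, map_zero, smul_zero, sub_zero] at this
  rw [norm_pow, norm_norm]
  linarith

/-- Second order expansion of a `C²` map along an arc `x(t) = t d + (t² / 2) w + o(t²)`. -/
theorem ContDiffAt.arc_expansion {V W : Type*} [NormedAddCommGroup V] [NormedSpace ℝ V]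
    [NormedAddCommGroup W] [NormedSpace ℝ W] {f : V → W} (hf : ContDiffAt ℝ 2 f 0)
    {x : ℝ → V} {d w : V}
    (hx : (fun t => x t - t • d - (t ^ 2 / 2) • w) =o[𝓝[>] 0] fun t => t ^ 2) :
    (fun t => f (x t) - f 0 - t • fderiv ℝ f 0 d
        - (t ^ 2 / 2) • (fderiv ℝ f 0 w + fderiv ℝ (fderiv ℝ f) 0 d d))
      =o[𝓝[>] 0] fun t => t ^ 2 := by
  set B := fderiv ℝ (fderiv ℝ f) 0
  have hpos : ∀ᶠ t : ℝ in 𝓝[>] 0, t ≠ 0 := eventually_mem_nhdsWithin.mono fun t ht => ne_of_gt ht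
  have hid : Tendsto (fun t : ℝ => t) (𝓝[>] 0) (𝓝 0) := tendsto_id.mono_left nhdsWithin_le_nhds
  -- The rescaled arc `x(t) / t` tends to `d`.
  have hlim : Tendsto (fun t => t⁻¹ • x t) (𝓝[>] 0) (𝓝 d) := by
    have h1 : (fun t => x t - t • d - (t ^ 2 / 2) • w) =o[𝓝[>] 0] fun t : ℝ => t :=
      hx.trans_isBigO <| by
        refine IsBigO.of_bound 1 ?_
        filter_upwards [hid.eventually (Metric.closedBall_mem_nhds (0 : ℝ) one_pos)] with t ht
        replace ht : ‖t‖ ≤ 1 := mem_closedBall_zero_iff.1 ht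
        rw [norm_pow, one_mul, pow_two]
        exact mul_le_of_le_one_left (norm_nonneg _) ht
    have h2 := h1.tendsto_inv_smul_nhds_zero
    have h3 : Tendsto (fun t : ℝ => d + (t / 2) • w) (𝓝[>] 0) (𝓝 d) := by
      have : Continuous fun t : ℝ => d + (t / 2) • w := by fun_prop
      simpa using (this.tendsto 0).mono_left nhdsWithin_le_nhds
    have h4 := h2.add h3
    rw [zero_add] at h4
    refine h4.congr' (hpos.mono fun t ht => ?_)
    simp only [smul_sub, smul_smul, inv_mul_cancel₀ ht, one_smul]
    have : t⁻¹ * (t ^ 2 / 2) = t / 2 := by field_simp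
    rw [this]; abel
  have hx0 : Tendsto x (𝓝[>] 0) (𝓝 0) := by
    have := hid.smul hlim
    rw [zero_smul] at this
    refine this.congr' (hpos.mono fun t ht => ?_)
    simp [smul_smul, mul_inv_cancel₀ ht]
  have hxO : (fun t => ‖x t‖ ^ 2) =O[𝓝[>] 0] fun t => t ^ 2 := by
    refine IsBigO.pow ?_ 2
    have h1 : (fun t => t⁻¹ • x t) =O[𝓝[>] 0] fun _ => (1 : ℝ) := hlim.isBigO_one ℝ
    have h2 := (isBigO_refl (fun t : ℝ => t) (𝓝[>] 0)).smul h1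
    simp only [smul_eq_mul, mul_one] at h2
    refine (h2.congr' (hpos.mono fun t ht => ?_) EventuallyEq.rfl).norm_left
    simp [smul_smul, mul_inv_cancel₀ ht]
  have h1 := (hf.taylor_two_isLittleO.comp_tendsto hx0).trans_isBigO hxO
  have h2 : (fun t => fderiv ℝ f 0 (x t - t • d - (t ^ 2 / 2) • w)) =o[𝓝[>] 0] fun t => t ^ 2 :=
    ((fderiv ℝ f 0).isBigO_comp _ _).trans_isLittleO hx
  have h3 : (fun t => (t ^ 2) • ((1 / 2 : ℝ) • (B (t⁻¹ • x t) (t⁻¹ • x t) - B d d)))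
      =o[𝓝[>] 0] fun t : ℝ => t ^ 2 := by
    have hc : Continuous fun v => B v v := by fun_prop
    have : Tendsto (fun t => (1 / 2 : ℝ) • (B (t⁻¹ • x t) (t⁻¹ • x t) - B d d)) (𝓝[>] 0) (𝓝 0) := by
      have := (((hc.tendsto d).comp hlim).sub_const (B d d)).const_smul (1 / 2 : ℝ)
      simpa using this
    have := (isBigO_refl (fun t : ℝ => t ^ 2) (𝓝[>] 0)).smul_isLittleO
      ((isLittleO_one_iff ℝ).2 this)
    simpa using this
  refine ((h1.add h2).add h3).congr' (hpos.mono fun t ht => ?_) EventuallyEq.rfl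
  have e1 : t ^ 2 • (1 / 2 : ℝ) • B (t⁻¹ • x t) (t⁻¹ • x t) = (1 / 2 : ℝ) • B (x t) (x t) := by
    simp only [map_smul, smul_apply, smul_smul]
    congr 1
    field_simp
  have e2 : t ^ 2 • (1 / 2 : ℝ) • B d d = (t ^ 2 / 2) • B d d := by
    rw [smul_smul]; congr 1; ring
  beta_reduce
  rw [smul_sub (1 / 2 : ℝ), smul_sub (t ^ 2), e1, e2]
  simp only [Function.comp_apply, map_sub, map_smul, smul_add, B]
  abel

/-- If `h` is a submersion at `0`, then a pair `(d, w)` satisfying the first and second order equations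
of tangency is the second order jet of an arc of zeros of `h`. The arc `t d + (t² / 2) w`
satisfies `h = o(t²)`, and surjectivity of the derivative moves it onto the zero set at a cost
proportional to this error. -/
theorem exists_arc_mem_zeros {V Y : Type*} [NormedAddCommGroup V] [NormedSpace ℝ V]
    [CompleteSpace V] [NormedAddCommGroup Y] [NormedSpace ℝ Y] [CompleteSpace Y] {h : V → Y}
    (hh : ContDiffAt ℝ 2 h 0) (h0 : h 0 = 0)
    (hsurj : Function.Surjective (fderiv ℝ h 0)) {d w : V} (hd : fderiv ℝ h 0 d = 0)
    (hw : fderiv ℝ h 0 w + fderiv ℝ (fderiv ℝ h) 0 d d = 0) :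
    ∃ x : ℝ → V, (∀ᶠ t in 𝓝[>] 0, h (x t) = 0) ∧
      (fun t => x t - t • d - (t ^ 2 / 2) • w) =o[𝓝[>] 0] fun t => t ^ 2 := by
  let b : ℝ → V := fun t => t • d + (t ^ 2 / 2) • w
  have hbo : (fun t => h (b t)) =o[𝓝[>] 0] fun t => t ^ 2 := by
    have := hh.arc_expansion (x := b) (d := d) (w := w) (by simp [b])
    simpa [h0, hd, hw] using this
  have hb0 : Tendsto b (𝓝[>] 0) (𝓝 0) := by
    have : Continuous b := by fun_prop
    simpa [b] using (this.tendsto 0).mono_left nhdsWithin_le_nhds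
  have hrange : (fderiv ℝ h 0).range = ⊤ := LinearMap.range_eq_top.2 hsurj
  let S := (fderiv ℝ h 0).nonlinearRightInverseOfSurjective hrange
  have hS : 0 < S.nnnorm := ContinuousLinearMap.nonlinearRightInverseOfSurjective_nnnorm_pos _ hrange
  obtain ⟨s, hs, happ⟩ := (hh.hasStrictFDerivAt (by norm_num)).approximates_deriv_on_nhds
    (c := S.nnnorm⁻¹ / 2) (Or.inr (by positivity))
  obtain ⟨ε, hε, hball⟩ := Metric.nhds_basis_ball.mem_iff.1 hs
  have hS' : (0 : ℝ) < S.nnnorm := hS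
  -- The inverse of the openness ratio `S.nnnorm⁻¹ - c` obtained for `c = S.nnnorm⁻¹ / 2`.
  set k : ℝ := 2 * S.nnnorm with hk
  have hko : (fun t => k * ‖h (b t)‖) =o[𝓝[>] 0] fun t => t ^ 2 := hbo.norm_left.const_mul_left k
  have hk0 : Tendsto (fun t => k * ‖h (b t)‖) (𝓝[>] 0) (𝓝 0) := by
    refine hko.trans_tendsto ?_
    have : Continuous fun t : ℝ => t ^ 2 := by fun_prop
    simpa using (this.tendsto 0).mono_left nhdsWithin_le_nhds
  have hex : ∀ᶠ t in 𝓝[>] 0, ∃ x, h x = 0 ∧ ‖x - b t‖ ≤ k * ‖h (b t)‖ := by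
    have hsum : Tendsto (fun t => ‖b t‖ + k * ‖h (b t)‖) (𝓝[>] 0) (𝓝 0) := by
      simpa using hb0.norm.add hk0
    filter_upwards [hsum.eventually (gt_mem_nhds hε)] with t ht
    have hsub : Metric.closedBall (b t) (k * ‖h (b t)‖) ⊆ s := by
      refine Subset.trans (fun y hy => ?_) hball
      rw [Metric.mem_ball, dist_zero_right]
      rw [Metric.mem_closedBall, dist_eq_norm] at hy
      have := norm_add_le (y - b t) (b t)
      rw [sub_add_cancel] at this
      linarith
    have hsurjOn := happ.surjOn_closedBall_of_nonlinearRightInverse S (by positivity) hsub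
    have hrad : ((S.nnnorm : ℝ)⁻¹ - ((S.nnnorm⁻¹ / 2 : NNReal) : ℝ)) * (k * ‖h (b t)‖)
        = ‖h (b t)‖ := by
      push_cast
      rw [hk]; field_simp; ring
    rw [hrad] at hsurjOn
    obtain ⟨x, hx, hx0⟩ := hsurjOn (a := 0) (by simp [dist_eq_norm])
    exact ⟨x, hx0, by simpa [dist_eq_norm] using hx⟩
  obtain ⟨x, hx⟩ := hex.choice
  refine ⟨x, hx.mono fun t ht => ht.1, ?_⟩
  refine (IsBigO.of_bound 1 (hx.mono fun t ht => ?_)).trans_isLittleO hko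
  rw [one_mul, sub_sub]
  exact ht.2.trans (le_abs_self _)

/-- At a local minimizer no second order correction `w` of a tangent direction `d` strictly decreases
`f` and all the `gₗ` at second order while preserving `h = 0`. -/
theorem NLP.not_exists_second_order_descent {V Y ι : Type*} [Fintype ι]
    [NormedAddCommGroup V] [NormedSpace ℝ V]
    [CompleteSpace V] [NormedAddCommGroup Y] [NormedSpace ℝ Y] [CompleteSpace Y]
    {f : V → ℝ} {h : V → Y} {g : V → EuclideanSpace ℝ ι} {S : Set V}
    (hf : ContDiffAt ℝ 2 f 0) (hh : ContDiffAt ℝ 2 h 0) (hg : ContDiffAt ℝ 2 g 0)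
    (h0 : h 0 = 0) (g0 : g 0 = 0) (hsurj : Function.Surjective (fderiv ℝ h 0))
    (hS : ∀ᶠ x in 𝓝 0, h x = 0 → (∀ l, g x l ≤ 0) → x ∈ S) (hmin : IsLocalMinOn f S 0)
    {d : V} (hhd : fderiv ℝ h 0 d = 0) (hgd : fderiv ℝ g 0 d = 0) (hfd : fderiv ℝ f 0 d = 0) :
    ¬ ∃ w, fderiv ℝ h 0 w + fderiv ℝ (fderiv ℝ h) 0 d d = 0 ∧
      (∀ l, fderiv ℝ g 0 w l + fderiv ℝ (fderiv ℝ g) 0 d d l < 0) ∧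
      fderiv ℝ f 0 w + fderiv ℝ (fderiv ℝ f) 0 d d < 0 := by
  rintro ⟨w, hw, hgw, hfw⟩
  obtain ⟨x, hxh, hx⟩ := exists_arc_mem_zeros hh h0 hsurj hhd hw
  have hx0 : Tendsto x (𝓝[>] 0) (𝓝 0) := by
    have h1 : Tendsto (fun t : ℝ => t ^ 2) (𝓝[>] 0) (𝓝 0) := by
      have : Continuous fun t : ℝ => t ^ 2 := by fun_prop
      simpa using (this.tendsto 0).mono_left nhdsWithin_le_nhds
    have h2 : Tendsto (fun t : ℝ => t • d + (t ^ 2 / 2) • w) (𝓝[>] 0) (𝓝 0) := by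
      have : Continuous fun t : ℝ => t • d + (t ^ 2 / 2) • w := by fun_prop
      simpa using (this.tendsto 0).mono_left nhdsWithin_le_nhds
    have := (hx.trans_tendsto h1).add h2
    simpa [sub_sub] using this
  -- A remainder `o(t²)` does not change the sign of a negative coefficient of `t² / 2`.
  have hneg : ∀ {φ : ℝ → ℝ} {q : ℝ}, (fun t => φ t - (t ^ 2 / 2) * q) =o[𝓝[>] 0] (fun t => t ^ 2) →
      q < 0 → ∀ᶠ t in 𝓝[>] 0, φ t < 0 := by
    intro φ q hφ hq
    filter_upwards [hφ.def (c := -q / 4) (by linarith), eventually_mem_nhdsWithin] with t ht htpos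
    have ht2 : 0 < t ^ 2 := pow_pos htpos 2
    rw [Real.norm_eq_abs, Real.norm_of_nonneg ht2.le] at ht
    have := (abs_le.1 ht).2
    nlinarith [mul_neg_of_neg_of_pos hq ht2]
  have hgneg : ∀ᶠ t in 𝓝[>] 0, ∀ l, g (x t) l < 0 := by
    refine eventually_all.2 fun l => hneg ?_ (hgw l)
    have h1 := hg.arc_expansion hx
    have h2 := ((EuclideanSpace.proj l : EuclideanSpace ℝ ι →L[ℝ] ℝ).isBigO_comp _ _).trans_isLittleO
      h1
    simpa [g0, hgd, mul_add] using h2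
  have hfneg : ∀ᶠ t in 𝓝[>] 0, f (x t) - f 0 < 0 := by
    refine hneg ?_ hfw
    simpa [hfd] using hf.arc_expansion hx
  have hev : ∀ᶠ x in 𝓝 (0 : V), x ∈ S → f 0 ≤ f x := eventually_nhdsWithin_iff.1 hmin
  obtain ⟨t, ht1, ht2, ht3, ht4, ht5⟩ := (hxh.and (hgneg.and (hfneg.and
    ((hx0.eventually hS).and (hx0.eventually hev))))).exists
  have := ht5 (ht4 ht1 fun l => (ht2 l).le)
  linarith

/-! ### Second order conditions in coordinate-free form -/

section
variable {V Y ι : Type*} [Fintype ι]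
    [NormedAddCommGroup V] [NormedSpace ℝ V] [FiniteDimensional ℝ V]
    [NormedAddCommGroup Y] [NormedSpace ℝ Y] [FiniteDimensional ℝ Y]
    {f : V → ℝ} {h : V → Y} {g : V → EuclideanSpace ℝ ι} {S : Set V}

/-- Second order necessary condition for a single direction `d`: the multiplier may depend on `d`. -/
theorem NLP.exists_multiplier_of_direction
    (hf : ContDiffAt ℝ 2 f 0) (hh : ContDiffAt ℝ 2 h 0) (hg : ContDiffAt ℝ 2 g 0)
    (h0 : h 0 = 0) (g0 : g 0 = 0) (hsurj : Function.Surjective (fderiv ℝ h 0))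
    (hMF : ∃ d, fderiv ℝ h 0 d = 0 ∧ ∀ l, fderiv ℝ g 0 d l < 0)
    (hS : ∀ᶠ x in 𝓝 0, h x = 0 → (∀ l, g x l ≤ 0) → x ∈ S) (hmin : IsLocalMinOn f S 0)
    {d : V} (hhd : fderiv ℝ h 0 d = 0) (hgd : fderiv ℝ g 0 d = 0) :
    ∃ (Λ : Y →L[ℝ] ℝ) (μ : ι → ℝ),
      μ ∈ NLP.multiplierSet (fderiv ℝ h 0) (fderiv ℝ f 0) (fderiv ℝ g 0) ∧
      (∀ v, fderiv ℝ f 0 v + Λ (fderiv ℝ h 0 v) + ∑ l, μ l * fderiv ℝ g 0 v l = 0) ∧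
      0 ≤ fderiv ℝ (fderiv ℝ f) 0 d d + Λ (fderiv ℝ (fderiv ℝ h) 0 d d) +
        ∑ l, μ l * fderiv ℝ (fderiv ℝ g) 0 d d l := by
  have : CompleteSpace V := FiniteDimensional.complete ℝ V
  have : CompleteSpace Y := FiniteDimensional.complete ℝ Y
  -- The alternative at the direction `0` gives a first order multiplier, hence `f' d = 0`.
  have hfd : fderiv ℝ f 0 d = 0 := by
    obtain ⟨μ, hμ, hnn⟩ := motzkin_alternative hsurj (fderiv ℝ f 0) (fderiv ℝ g 0) _ _ _ hMF
      (NLP.not_exists_second_order_descent hf hh hg h0 g0 hsurj hS hmin (map_zero _) (map_zero _)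
        (map_zero _))
    simpa [hgd] using (NLP.mem_multiplierSet_of_forall_nonneg hsurj hμ hnn).2 d hhd
  obtain ⟨μ, hμ, hnn⟩ := motzkin_alternative hsurj (fderiv ℝ f 0) (fderiv ℝ g 0) _ _ _ hMF
    (NLP.not_exists_second_order_descent hf hh hg h0 g0 hsurj hS hmin hhd hgd hfd)
  have hmem := NLP.mem_multiplierSet_of_forall_nonneg hsurj hμ hnn
  obtain ⟨Λ, hΛ⟩ := NLP.exists_equality_multiplier hsurj hmem
  refine ⟨Λ, μ, hmem, hΛ, ?_⟩
  obtain ⟨w, hw⟩ := hsurj (-fderiv ℝ (fderiv ℝ h) 0 d d)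
  have h1 := hnn w (by simp [hw])
  have h2 := hΛ w
  rw [hw, map_neg] at h2
  simp only [mul_add, Finset.sum_add_distrib] at h1
  linarith

/-- Second order necessary condition with one multiplier for all directions, in a coordinate-free
form: the multiplier of the equality constraints is a functional `Λ`. -/
theorem NLP.exists_multiplier_forall_direction
    (hf : ContDiffAt ℝ 2 f 0) (hh : ContDiffAt ℝ 2 h 0) (hg : ContDiffAt ℝ 2 g 0)
    (h0 : h 0 = 0) (g0 : g 0 = 0) (hsurj : Function.Surjective (fderiv ℝ h 0))
    (hMF : ∃ d, fderiv ℝ h 0 d = 0 ∧ ∀ l, fderiv ℝ g 0 d l < 0)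
    (hS : ∀ᶠ x in 𝓝 0, h x = 0 → (∀ l, g x l ≤ 0) → x ∈ S) (hmin : IsLocalMinOn f S 0)
    (hrank : ∀ᶠ x in 𝓝 0, Module.finrank ℝ (LinearMap.range
        ((fderiv ℝ h x).prod (fderiv ℝ g x) : V →ₗ[ℝ] Y × EuclideanSpace ℝ ι)) ≤
      Module.finrank ℝ (LinearMap.range
        ((fderiv ℝ h 0).prod (fderiv ℝ g 0) : V →ₗ[ℝ] Y × EuclideanSpace ℝ ι)) + 1) :
    ∃ (Λ : Y →L[ℝ] ℝ) (μ : ι → ℝ), (∀ l, 0 ≤ μ l) ∧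
      (∀ v, fderiv ℝ f 0 v + Λ (fderiv ℝ h 0 v) + ∑ l, μ l * fderiv ℝ g 0 v l = 0) ∧
      ∀ d, fderiv ℝ h 0 d = 0 → fderiv ℝ g 0 d = 0 →
        0 ≤ fderiv ℝ (fderiv ℝ f) 0 d d + Λ (fderiv ℝ (fderiv ℝ h) 0 d d) +
          ∑ l, μ l * fderiv ℝ (fderiv ℝ g) 0 d d l := by
  let D : V → V →L[ℝ] (Y × EuclideanSpace ℝ ι) := fun x => (fderiv ℝ h x).prod (fderiv ℝ g x)
  -- The bounded linear map `(a, b) ↦ a.prod b`, through which `D` is differentiated.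
  let J : ((V →L[ℝ] Y) × (V →L[ℝ] EuclideanSpace ℝ ι)) →L[ℝ] (V →L[ℝ] (Y × EuclideanSpace ℝ ι)) :=
    (ContinuousLinearMap.prodₗᵢ ℝ).toContinuousLinearEquiv.toContinuousLinearMap
  let B : V →L[ℝ] V →L[ℝ] (Y × EuclideanSpace ℝ ι) :=
    J.comp ((fderiv ℝ (fderiv ℝ h) 0).prod (fderiv ℝ (fderiv ℝ g) 0))
  have hB : ∀ u v, B u v = (fderiv ℝ (fderiv ℝ h) 0 u v, fderiv ℝ (fderiv ℝ g) 0 u v) :=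
    fun u v => rfl
  have hBs : ∀ u v, B u v = B v u := fun u v => by
    rw [hB, hB, hh.fderiv_fderiv_comm, hg.fderiv_fderiv_comm]
  have hD : HasFDerivAt D B 0 :=
    J.hasFDerivAt.comp (0 : V) (hh.hasFDerivAt_fderiv.prodMk hg.hasFDerivAt_fderiv)
  let K : Submodule ℝ V := LinearMap.ker (D 0 : V →ₗ[ℝ] (Y × EuclideanSpace ℝ ι))
  have hK : ∀ d, d ∈ K ↔ fderiv ℝ h 0 d = 0 ∧ fderiv ℝ g 0 d = 0 := fun d =>
    (LinearMap.mem_ker (f := (D 0 : V →ₗ[ℝ] (Y × EuclideanSpace ℝ ι)))).trans Prod.ext_iff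
  let N : Set ((Y × EuclideanSpace ℝ ι) →L[ℝ] ℝ) := {η | ∀ v, η (D 0 v) = 0}
  obtain ⟨φ, w, hφ⟩ := exists_form_of_minors_eq_zero K N B
    hBs
    (fun η₁ h₁ η₂ h₂ z _ u₁ hu₁ u₂ hu₂ =>
      minor_eq_zero_of_finrank_le hD hrank h₁ h₂ hu₁ hu₂)
  -- A multiplier `(Λ, μ)`, seen as a linear functional on the space of constraint values.
  let π : (Y →L[ℝ] ℝ) → (ι → ℝ) → (Y × EuclideanSpace ℝ ι) →L[ℝ] ℝ := fun Λ μ =>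
    Λ.coprod (∑ l, μ l • (EuclideanSpace.proj l : EuclideanSpace ℝ ι →L[ℝ] ℝ))
  have hπ : ∀ Λ μ y, π Λ μ y = Λ y.1 + ∑ l, μ l * y.2 l := fun Λ μ y => by
    simp [π, sum_apply]
  -- By stationarity at `v₀`, the value at `w` of the multiplier `(Λ, μ)` is the affine function
  -- `τ` of `μ` alone.
  obtain ⟨v₀, hv₀⟩ := hsurj w.1
  let τ : (ι → ℝ) → ℝ := fun μ => -fderiv ℝ f 0 v₀ + ∑ l, μ l * (w.2 l - fderiv ℝ g 0 v₀ l)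
  have hτ : ∀ (Λ : Y →L[ℝ] ℝ) (μ : ι → ℝ),
      (∀ v, fderiv ℝ f 0 v + Λ (fderiv ℝ h 0 v) + ∑ l, μ l * fderiv ℝ g 0 v l = 0) → π Λ μ w = τ μ := by
    intro Λ μ hΛ
    have := hΛ v₀
    rw [hv₀] at this
    simp only [hπ, τ, mul_sub, Finset.sum_sub_distrib]
    linarith
  let M := NLP.multiplierSet (fderiv ℝ h 0) (fderiv ℝ f 0) (fderiv ℝ g 0)
  have hTc : IsCompact (τ '' M) :=
    (NLP.isCompact_multiplierSet hMF).image (by fun_prop)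
  have hTconv : Convex ℝ (τ '' M) := by
    rintro _ ⟨μ, hμ, rfl⟩ _ ⟨ν, hν, rfl⟩ s t hs ht hst
    refine ⟨s • μ + t • ν, NLP.convex_multiplierSet hμ hν hs ht hst, ?_⟩
    simp only [τ, Pi.add_apply, Pi.smul_apply, smul_eq_mul, add_mul, mul_assoc,
      Finset.sum_add_distrib, ← Finset.mul_sum]
    linear_combination fderiv ℝ f 0 v₀ * hst
  have hdir := fun {d : V} =>
    NLP.exists_multiplier_of_direction hf hh hg h0 g0 hsurj hMF hS hmin (d := d)
  obtain ⟨Λ₀, μ₀, -, hΛ₀, -⟩ := hdir (map_zero _) (map_zero _)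
  let post : ((Y × EuclideanSpace ℝ ι) →L[ℝ] ℝ) → V →L[ℝ] V →L[ℝ] ℝ := fun η =>
    (ContinuousLinearMap.compL ℝ V (Y × EuclideanSpace ℝ ι) ℝ η).comp B
  have hpost : ∀ η u v, post η u v = η (B u v) := fun _ _ _ => rfl
  let H := post φ
  let P := fderiv ℝ (fderiv ℝ f) 0 + post (π Λ₀ μ₀) - (π Λ₀ μ₀ w) • H
  -- On `K`, the Hessian of the Lagrangian depends on the multiplier through `τ μ` only.
  have hLag : ∀ (Λ : Y →L[ℝ] ℝ) (μ : ι → ℝ), (∀ v, fderiv ℝ f 0 v + Λ (fderiv ℝ h 0 v) +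
      ∑ l, μ l * fderiv ℝ g 0 v l = 0) → ∀ d ∈ K, P d d + τ μ * H d d =
        fderiv ℝ (fderiv ℝ f) 0 d d + Λ (fderiv ℝ (fderiv ℝ h) 0 d d) +
          ∑ l, μ l * fderiv ℝ (fderiv ℝ g) 0 d d l := by
    intro Λ μ hΛ d hd
    -- The difference of two multipliers annihilates the range of the derivative of the constraints.
    have hN : π Λ μ - π Λ₀ μ₀ ∈ N := by
      intro v
      have h1 := hΛ v
      have h2 := hΛ₀ v
      rw [sub_apply, hπ, hπ]
      simp only [D, ContinuousLinearMap.prod_apply]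
      linarith
    have h1 := hφ _ hN d hd
    have h2 : π Λ μ (B d d) = Λ (fderiv ℝ (fderiv ℝ h) 0 d d) +
        ∑ l, μ l * fderiv ℝ (fderiv ℝ g) 0 d d l := hπ Λ μ (B d d)
    rw [← hτ Λ μ hΛ]
    simp only [sub_apply] at h1
    simp only [P, H, sub_apply, add_apply, smul_apply, smul_eq_mul, hpost]
    linear_combination -h1 + h2
  obtain ⟨_, ⟨μ, hμ, rfl⟩, hpos⟩ := exists_parameter_forall_nonneg K P H
    (fun u v => by
      simp only [P, H, sub_apply, add_apply, smul_apply, hpost, hBs u v, hf.fderiv_fderiv_comm u v])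
    (fun u v => by simp only [H, hpost, hBs u v]) hTc hTconv
    (fun d hd => by
      obtain ⟨Λ, μ, hμ, hΛ, hnn⟩ := hdir ((hK d).1 hd).1 ((hK d).1 hd).2
      exact ⟨τ μ, ⟨μ, hμ, rfl⟩, by rwa [hLag Λ μ hΛ d hd]⟩)
  obtain ⟨Λ, hΛ⟩ := NLP.exists_equality_multiplier hsurj hμ
  refine ⟨Λ, μ, hμ.1, hΛ, fun d hhd hgd => ?_⟩
  have hd := (hK d).2 ⟨hhd, hgd⟩
  rw [← hLag Λ μ hΛ d hd]
  exact hpos d hd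
end

/-! ### Coordinates -/

theorem fderiv_apply_coord {V ι : Type*} [Fintype ι] [NormedAddCommGroup V] [NormedSpace ℝ V]
    {φ : V → EuclideanSpace ℝ ι} {x : V} (hφ : DifferentiableAt ℝ φ x) (i : ι) :
    fderiv ℝ (fun y => φ y i) x =
      (EuclideanSpace.proj i : EuclideanSpace ℝ ι →L[ℝ] ℝ).comp (fderiv ℝ φ x) :=
  ((EuclideanSpace.proj i : EuclideanSpace ℝ ι →L[ℝ] ℝ).hasFDerivAt.comp x
    hφ.hasFDerivAt).fderiv

theorem fderiv_fderiv_apply_coord {V ι : Type*} [Fintype ι] [NormedAddCommGroup V]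
    [NormedSpace ℝ V] {φ : V → EuclideanSpace ℝ ι} {x : V} (hφ : ContDiffAt ℝ 2 φ x) (i : ι)
    (u v : V) :
    fderiv ℝ (fderiv ℝ (fun y => φ y i)) x u v = fderiv ℝ (fderiv ℝ φ) x u v i := by
  have h1 : fderiv ℝ (fun y => φ y i) =ᶠ[𝓝 x] fun y =>
      (EuclideanSpace.proj i : EuclideanSpace ℝ ι →L[ℝ] ℝ).comp (fderiv ℝ φ y) :=
    (hφ.eventually (by simp)).mono fun y hy =>
      fderiv_apply_coord (hy.differentiableAt (by norm_num)) i
  have h2 : HasFDerivAt (fun y =>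
      (EuclideanSpace.proj i : EuclideanSpace ℝ ι →L[ℝ] ℝ).comp (fderiv ℝ φ y)) _ x :=
    (ContinuousLinearMap.compL ℝ V (EuclideanSpace ℝ ι) ℝ
      (EuclideanSpace.proj i)).hasFDerivAt.comp x hφ.hasFDerivAt_fderiv
  rw [h1.fderiv_eq, h2.fderiv]
  rfl

/-- The quadratic form of the Hessian matrix is the second derivative on the diagonal. -/
theorem dotProduct_hessian_mulVec {n : ℕ} (φ : NLP.E n → ℝ) (x d : NLP.E n) :
    d.ofLp ⬝ᵥ (NLP.hessian φ x).mulVec d.ofLp = fderiv ℝ (fderiv ℝ φ) x d d := by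
  have hd : d = ∑ i, d i • EuclideanSpace.single i (1 : ℝ) := by
    simpa using ((EuclideanSpace.basisFun (Fin n) ℝ).sum_repr d).symm
  conv_rhs => rw [hd]
  simp only [map_sum, map_smul, sum_apply, smul_apply, dotProduct, Matrix.mulVec, NLP.hessian,
    Matrix.of_apply, smul_eq_mul, Finset.mul_sum]
  rw [Finset.sum_comm]
  refine Finset.sum_congr rfl fun i _ => Finset.sum_congr rfl fun j _ => ?_
  ring

end

theorem mainTheorem1 (n m q : ℕ) (A : Set (NLP.E n)) (hA : IsOpen A) (h0A : (0 : NLP.E n) ∈ A)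
    (f : NLP.E n → ℝ) (h : NLP.E n → NLP.E m) (g : NLP.E n → NLP.E q)
    (hf : ContDiffOn ℝ 2 f A) (hh : ContDiffOn ℝ 2 h A) (hg : ContDiffOn ℝ 2 g A)
    (hh0 : h 0 = 0) (hg0 : g 0 = 0)
    (hmin : IsLocalMinOn f (NLP.feasibleSet A h g) 0)
    (hMF : NLP.MangasarianFromovitz h g)
    (hrank : ∀ x ∈ A, NLP.rank (NLP.Dhg h g x) ≤ NLP.rank (NLP.Dhg h g 0) + 1) :
    ∃ (lam : Fin m → ℝ) (mu : Fin q → ℝ),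
      NLP.IsLagrangeMultiplier f h g lam mu ∧
      ∀ d : NLP.E n, fderiv ℝ h 0 d = 0 → fderiv ℝ g 0 d = 0 →
        0 ≤ d.ofLp ⬝ᵥ (NLP.lagrangianHessian f h g lam mu).mulVec d.ofLp := by
  have hA0 := hA.mem_nhds h0A
  replace hf := hf.contDiffAt hA0
  replace hh := hh.contDiffAt hA0
  replace hg := hg.contDiffAt hA0
  have hsurj : Function.Surjective (fderiv ℝ h 0) := by
    have : LinearMap.range (fderiv ℝ h 0 : NLP.E n →ₗ[ℝ] NLP.E m) = ⊤ :=
      Submodule.eq_top_of_finrank_eq (by simpa [NLP.rank] using hMF.1)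
    exact LinearMap.range_eq_top.1 this
  obtain ⟨Λ, mu, hmu, hΛ, hpos⟩ := NLP.exists_multiplier_forall_direction hf hh hg hh0 hg0 hsurj hMF.2
    (S := NLP.feasibleSet A h g)
    (by filter_upwards [hA0] with x hx hxh hxg using ⟨hx, hxh, hxg⟩) hmin
    (by filter_upwards [hA0] with x hx using hrank x hx)
  -- The coordinates of the functional `Λ`.
  let lam : Fin m → ℝ := fun j => Λ (EuclideanSpace.single j 1)
  have hlam : ∀ y : NLP.E m, Λ y = ∑ j, lam j * y j := fun y => by
    have hy : y = ∑ j, y j • EuclideanSpace.single j (1 : ℝ) := by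
      simpa using ((EuclideanSpace.basisFun (Fin m) ℝ).sum_repr y).symm
    conv_lhs => rw [hy]
    simp [lam, mul_comm]
  refine ⟨lam, mu, ⟨hmu, ?_⟩, fun d hhd hgd => ?_⟩
  -- The stationarity condition is tested against an arbitrary vector `v`.
  · refine ext_inner_right ℝ fun v => ?_
    have := hΛ v
    rw [hlam] at this
    simpa [inner_add_left, sum_inner, inner_smul_left, gradient,
      fderiv_apply_coord (hh.differentiableAt (by norm_num)),
      fderiv_apply_coord (hg.differentiableAt (by norm_num))] using this
  · have := hpos d hhd hgd
    rw [hlam] at this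
    simpa [NLP.lagrangianHessian, Matrix.add_mulVec, Matrix.sum_mulVec, Matrix.smul_mulVec,
      dotProduct_sum, dotProduct_hessian_mulVec, fderiv_fderiv_apply_coord hh,
      fderiv_fderiv_apply_coord hg] using this
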